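/- **Consistency of guarded computational type theory.** There is no inhabitant of the void type: for every formal term $M$ without free term variables (in particular for every closed $M$), whose free clock variables are among those of a finite clock context $\Delta$, the internal proposition $[\![\Delta\mid\cdot\gg M = M\in\mathsf{void}]\!]$ given by the meaning explanation below holds at no world of the topos of clocks; equivalently, its negation is valid in the internal logic of that topos. *The topos.* A world $\mathbf U=(n,\partial)$ is a set of $n>0$ clock names with a function $\partial$ assigning to each clock name a natural number (the time left). A morphism $\mathbf V\to\mathbf U$ is a function $f$ from the clock names of $\mathbf U$ to those of $\mathbf V$ with $\partial_V(f\kappa)\le\partial_U(\kappa)$ for all $\kappa$. We work in the internal logic of the topos of presheaves on worlds. Let $\mathbb K$ be the presheaf of clock names. The modality $\triangleright_\kappa$ is defined by: $\mathbf U\Vdash\triangleright_\kappa\phi$ iff $\partial_U(\kappa)=0$, or $\partial_U(\kappa)=m+1$ and $\mathbf U[\kappa\mapsto m]\Vdash\phi$ (with parameters restricted along $\mathbf U[\kappa\mapsto m]\to\mathbf U$). *Syntax.* Formal terms (up to renaming of bound variables, with term variables $x,y,z$ and clock variables $k$) are $x,\ \lambda x.M,\ \lambda k.M,\ M\,N,\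 M\,k,\ \langle M,N\rangle,\ \mathsf{fst}\,M,\ \mathsf{snd}\,M,\ \mathsf{fix}\,x.M,\ \star,\ \mathsf{tt},\ \mathsf{ff},\ \mathsf{if}(M;N;O),\ \mathsf{ze},\ \mathsf{su}(M),\ \mathsf{ifze}(M;N;x.O),\ \mathsf{sup}(M;x.N),\ \mathsf{wrec}(M;x.y.z.N)$, and the types $(x:A)\to B,\ (x:A)\times B,\ \mathsf W(x:A)B,\ \mathsf{Eq}_A(M,N),\ \prod_k A,\ \bigcap_k A,\ \triangleright_k A,\ \mathsf{void},\ \mathsf{unit},\ \mathsf{bool},\ \mathsf{nat},\ \mathsf U_i$ ($i\in\mathbb N$). Programs $\mathsf{Tm}_n$ with $n$ free term variables are the internal inductive definition in the topos with the same operators, except that clocks are elements of $\mathbb K$ and the operators binding a clock take an element of $\mathsf{Tm}_n^{\mathbb K}$. A formal term $M$ and an environment $\varrho:\mathbb K^\Delta$ elaborate to a program $[\![M]\!]\varrho$, operator by operator; write $\mathsf{Tm}=\mathsf{Tm}_0$. *Operational semantics.* Programs run by call-by-name small steps: elimination forms evaluate their principal argument, with the $\beta$-rules $(\lambda x.M)N\mapsto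 M[N/x]$, $(\lambda M)\kappa\mapsto M(\kappa)$, $\mathsf{fst}\langle M,N\rangle\mapsto M$, $\mathsf{snd}\langle M,N\rangle\mapsto N$, the evident rules for $\mathsf{if}$ and $\mathsf{ifze}$ (the latter substituting the predecessor), $\mathsf{wrec}(\mathsf{sup}(M;x.N);O)\mapsto O[M,\ \lambda x.N,\ \lambda x.\mathsf{wrec}(N;O)]$, and $\mathsf{fix}\,x.M\mapsto M[\mathsf{fix}\,x.M/x]$. Values are all introduction forms ($\lambda$, clock $\lambda$, pairs, $\star$, $\mathsf{tt}$, $\mathsf{ff}$, $\mathsf{ze}$, $\mathsf{su}$, $\mathsf{sup}$) and all type formers. Write $\Downarrow$ for reduction in any number of steps to a value, and $\mathcal R^{\Downarrow}$ for the pairs of closed programs that evaluate to values related by $\mathcal R$; similarly, for a set $\tau$ of pairs (program, relation), $\tau^{\Downarrow}$ is the set of $(A,\mathcal A)$ such that $A\Downarrow A_v$ with $(A_v,\mathcal A)\in\tau$. *Type systems.* A candidate type system is an element of $\mathcal P(\mathsf{Tm}\times\mathcal P(\mathsf{Tm}\times\mathsf{Tm}))$. For $\sigma$ such a system, let $\mathsf{Clo}(\sigma)$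 be the least fixed point of $\tau\mapsto\sigma\cup(\mathsf{Conn}\,\tau)^{\Downarrow}$, where $\mathsf{Conn}\,\tau$ consists of the pairs: - $(\mathsf{void},\varnothing)$; $(\mathsf{unit},\{(\star,\star)\}^{\Downarrow})$; $(\mathsf{bool},\{(\mathsf{tt},\mathsf{tt}),(\mathsf{ff},\mathsf{ff})\}^{\Downarrow})$; $(\mathsf{nat},\mathcal N^{\Downarrow})$ with $\mathcal N=\mu\mathcal Y.\{(\mathsf{ze},\mathsf{ze})\}\cup\{(\mathsf{su}M_0,\mathsf{su}M_1)\mid(M_0,M_1)\in\mathcal Y^{\Downarrow}\}$; - for $(A,\mathcal A)\in\tau$ and $\mathcal B:\mathsf{Tm}\to\mathcal P(\mathsf{Tm}\times\mathsf{Tm})$ such that $(B[M_i],\mathcal B(M_j))\in\tau$ for all $(M_0,M_1)\in\mathcal A$ and $i,j\in\{0,1\}$: the pair of $(x:A)\times B$ and $\{(M_0,M_1)\mid(\mathsf{fst}M_0,\mathsf{fst}M_1)\in\mathcal A\wedge(\mathsf{snd}M_0,\mathsf{snd}M_1)\in\mathcal B(\mathsf{fst}M_0)\}$; the pair of $(x:A)\to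 B$ and $\{(M_0,M_1)\mid\forall(N_0,N_1)\in\mathcal A.\,(M_0N_0,M_1N_1)\in\mathcal B(N_0)\}$; the pair of $\mathsf W(x:A)B$ and $\mathcal X^{\Downarrow}$ with $\mathcal X=\mu\mathcal Y.\{(\mathsf{sup}(M_0;N_0),\mathsf{sup}(M_1;N_1))\mid(M_0,M_1)\in\mathcal A\wedge\forall(O_0,O_1)\in\mathcal B(M_0).\,(N_0[O_0],N_1[O_1])\in\mathcal Y^{\Downarrow}\}$; - $(\mathsf{Eq}_A(M_0,M_1),\{(\star,\star)\mid(M_0,M_1)\in\mathcal A\}^{\Downarrow})$ for $(A,\mathcal A)\in\tau$ and $(M_0,M_0),(M_1,M_1)\in\mathcal A$; - $(\triangleright_\kappa A,\{(M_0,M_1)\mid\triangleright_\kappa((M_0,M_1)\in\mathcal A)\})$ when $\triangleright_\kappa((A,\mathcal A)\in\tau)$; - $(\bigcap A,\{(M_0,M_1)\mid\forall\kappa.(M_0,M_1)\in\mathcal A(\kappa)\})$ and $(\prod A,\{(M_0,M_1)\mid\forall\kappa.(M_0\,\kappa,M_1\,\kappa)\in\mathcal A(\kappa)\})$ when $(A(\kappa),\mathcal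 A(\kappa))\in\tau$ for all $\kappa:\mathbb K$. Put $\tau\models A\sim B$ if $(A,\mathcal A),(B,\mathcal A)\in\tau$ for some $\mathcal A$, and $\tau\models M\sim N\in A$ if $(A,\mathcal A)\in\tau$ and $(M,N)\in\mathcal A$ for some $\mathcal A$. Let $\nu_0=\varnothing$, $\nu_{n+1}=\{(\mathsf U_i,\{(A_0,A_1)\mid\mathsf{Clo}(\nu_i)\models A_0\sim A_1\})\mid i\le n\}^{\Downarrow}$ and $\tau_\omega=\bigcup_n\mathsf{Clo}(\nu_n)$. *Meaning explanation.* For a telescope $\Gamma$ and tuples $\gamma_0,\gamma_1$ of closed programs, $\gamma_0\sim\gamma_1\in\Gamma$ means that corresponding entries $M_0,M_1$ satisfy $\tau_\omega\models M_0\sim M_1\in A[\gamma_0]$, where $A$ is the corresponding entry of $\Gamma$. Then $\Gamma\gg A_0\sim A_1$ (resp. $\Gamma\gg M_0\sim M_1\in A$) means that $\tau_\omega\models A_0[\gamma_0]\sim A_1[\gamma_1]$ (resp. $\tau_\omega\models M_0[\gamma_0]\sim M_1[\gamma_1]\in A[\gamma_0]$) for all $\gamma_0\sim\gamma_1\in\Gamma$;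 $\Gamma$ is a valid context if each entry $A$ satisfies $\Gamma'\gg A\sim A$ over the entries $\Gamma'$ before it. Finally $[\![\Delta\mid\Gamma\gg M_0=M_1\in A]\!]$ is the internal proposition: for all $\varrho:\mathbb K^\Delta$, if $[\![\Gamma]\!]\varrho$ is a valid context and $[\![\Gamma]\!]\varrho\gg[\![A]\!]\varrho\sim[\![A]\!]\varrho$, then $[\![\Gamma]\!]\varrho\gg[\![M_0]\!]\varrho\sim[\![M_1]\!]\varrho\in[\![A]\!]\varrho$. -/

import Mathlib

open CategoryTheory

namespace GCTT

/-! ## The base category of clock worlds -/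

/-- A world: a finite nonempty collection of clock names, identified with `Fin size`, together
with the amount of time left on each clock. -/
structure World where
  size : ℕ
  size_pos : 0 < size
  time : Fin size → ℕ

/-- A morphism `V ⟶ U` of worlds: a function from the clock names of `U` to those of `V` along
which the times of `V` are bounded by those of `U`. -/
@[ext]
structure World.Hom (V U : World) where
  map : Fin U.size → Fin V.size
  le : ∀ κ, V.time (map κ) ≤ U.time κ

instance : Category World where
  Hom := World.Hom
  id U := ⟨fun κ => κ, fun _ => le_rfl⟩
  comp g f := ⟨fun κ => g.map (f.map κ), fun κ => (g.le _).trans (f.le κ)⟩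

/-- `U[κ ↦ n]`. -/
def World.set (U : World) (κ : Fin U.size) (n : ℕ) : World :=
  ⟨U.size, U.size_pos, Function.update U.time κ n⟩

/-- The morphism `U[κ ↦ n] ⟶ U` that is the identity on clock names, for `n ≤ ∂_U(κ)`. -/
def World.incr (U : World) (κ : Fin U.size) (n : ℕ) (h : n ≤ U.time κ) : U.set κ n ⟶ U :=
  World.Hom.mk (V := U.set κ n) (fun k => k) (fun k => by
    by_cases hk : k = κ
    · subst hk; simpa [World.set] using h
    · simp [World.set, hk])

/-! ## Presheaves on worlds -/

/-- The structure of a presheaf on a family of sets indexed by worlds. -/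
class Presheaf (X : World → Type) where
  /-- restriction along a morphism of worlds -/
  res : ∀ {V U : World}, (V ⟶ U) → X U → X V
  res_id : ∀ {U : World} (x : X U), res (𝟙 U) x = x
  res_comp : ∀ {W V U : World} (g : W ⟶ V) (f : V ⟶ U) (x : X U),
    res (g ≫ f) x = res g (res f x)

open Presheaf (res res_id res_comp)

/-- The presheaf of clock names. -/
def Clock (U : World) : Type := Fin U.size

instance : Presheaf Clock where
  res f κ := f.map κ
  res_id _ := rfl
  res_comp _ _ _ := rfl

/-- Binary products of presheaves. -/
@[ext]
structure Pair (X Y : World → Type) (U : World) where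
  fst : X U
  snd : Y U

instance (X Y : World → Type) [Presheaf X] [Presheaf Y] : Presheaf (Pair X Y) where
  res f p := ⟨res f p.fst, res f p.snd⟩
  res_id p := by simp [res_id]
  res_comp g f p := by simp [res_comp]

@[simp] theorem res_mk {X Y : World → Type} [Presheaf X] [Presheaf Y] {U V : World}
    (f : V ⟶ U) (x : X U) (y : Y U) :
    res f (⟨x, y⟩ : Pair X Y U) = ⟨res f x, res f y⟩ := rfl

@[simp] theorem res_fst {X Y : World → Type} [Presheaf X] [Presheaf Y] {U V : World}
    (f : V ⟶ U) (p : Pair X Y U) : (res f p).fst = res f p.fst := rfl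

@[simp] theorem res_snd {X Y : World → Type} [Presheaf X] [Presheaf Y] {U V : World}
    (f : V ⟶ U) (p : Pair X Y U) : (res f p).snd = res f p.snd := rfl

/-- The exponential `Y ^ X`: an element at stage `U` is a natural transformation from
`y(U) × X` to `Y`. -/
@[ext]
structure Exp (X Y : World → Type) [Presheaf X] [Presheaf Y] (U : World) where
  app : ∀ {V : World}, (V ⟶ U) → X V → Y V
  nat : ∀ {V W : World} (f : V ⟶ U) (g : W ⟶ V) (x : X V),
    res g (app f x) = app (g ≫ f) (res g x)

instance (X Y : World → Type) [Presheaf X] [Presheaf Y] : Presheaf (Exp X Y) where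
  res f e := ⟨fun g x => e.app (g ≫ f) x, fun g h x => by simp [e.nat]⟩
  res_id e := by ext; simp
  res_comp g f e := by ext; simp

/-- The power object `Ω ^ X`: an element at stage `U` is a subpresheaf of `y(U) × X`. -/
@[ext]
structure Pow (X : World → Type) [Presheaf X] (U : World) where
  mem : ∀ {V : World}, (V ⟶ U) → X V → Prop
  mono : ∀ {V W : World} (f : V ⟶ U) (g : W ⟶ V) (x : X V), mem f x → mem (g ≫ f) (res g x)

instance (X : World → Type) [Presheaf X] : Presheaf (Pow X) where
  res f P := ⟨fun g x => P.mem (g ≫ f) x, fun g h x hx => by simpa using P.mono _ h x hx⟩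
  res_id P := by ext; simp
  res_comp g f P := by ext; simp

@[simp] theorem Exp.res_app {X Y : World → Type} [Presheaf X] [Presheaf Y] {U V W : World}
    (f : V ⟶ U) (e : Exp X Y U) (g : W ⟶ V) (x : X W) :
    (res f e).app g x = e.app (g ≫ f) x := rfl

@[simp] theorem Pow.res_mem {X : World → Type} [Presheaf X] {U V W : World}
    (f : V ⟶ U) (P : Pow X U) (g : W ⟶ V) (x : X W) :
    (res f P).mem g x ↔ P.mem (g ≫ f) x := Iff.rfl

/-- A global element of a presheaf. -/
structure Global (X : World → Type) [Presheaf X] where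
  val : ∀ U, X U
  nat : ∀ {V U : World} (f : V ⟶ U), res f (val U) = val V

section Pow
variable {X : World → Type} [Presheaf X]

/-- `U ⊩ P ⊆ Q`. -/
def Pow.le {U : World} (P Q : Pow X U) : Prop :=
  ∀ (V : World) (f : V ⟶ U) (x : X V), P.mem f x → Q.mem f x

/-- The union of two subobjects. -/
def Pow.union {U : World} (P Q : Pow X U) : Pow X U :=
  ⟨fun f x => P.mem f x ∨ Q.mem f x, fun f g x h => h.imp (P.mono f g x) (Q.mono f g x)⟩

/-- The empty subobject. -/
def Pow.empty {U : World} : Pow X U := ⟨fun _ _ => False, fun _ _ _ h => h⟩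

/-- The internal Knaster-Tarski least fixed point `⋂ {Y | F Y ⊆ Y}` of an operator on a
power object. -/
def Pow.lfp {U : World} (F : Exp (Pow X) (Pow X) U) : Pow X U where
  mem {V} f x := ∀ {W : World} (g : W ⟶ V) (Y : Pow X W),
    (F.app (g ≫ f) Y).le Y → Y.mem (𝟙 W) (res g x)
  mono f g x h := fun k Y hY => by
    have := h (k ≫ g) Y (by simpa using hY)
    simpa [res_comp] using this

theorem Pow.res_lfp {U V : World} (f : V ⟶ U) (F : Exp (Pow X) (Pow X) U) :
    res f (Pow.lfp F) = Pow.lfp (res f F) := by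
  ext W g x
  simp [res, Pow.lfp]

end Pow

/-- The forcing clause of the later modality: `U ⊩ ▷κ φ`, where `φ` is a proposition at
stage `U` given by the morphisms into `U` along which it holds. -/
def Later {U : World} (κ : Clock U) (φ : ∀ {V : World}, (V ⟶ U) → Prop) : Prop :=
  ∀ (n : ℕ) (h : U.time κ = n + 1), φ (U.incr κ n (by omega))

theorem Later.mono {U V : World} {κ : Clock U} {φ : ∀ {V : World}, (V ⟶ U) → Prop}
    (hφ : ∀ {V W : World} (f : V ⟶ U) (g : W ⟶ V), φ f → φ (g ≫ f))
    (g : V ⟶ U) (h : Later κ φ) : Later (res g κ) (fun f => φ (f ≫ g)) := by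
  intro n hn
  have hle : V.time (g.map κ) ≤ U.time κ := World.Hom.le g κ
  have hn' : V.time (g.map κ) = n + 1 := hn
  obtain ⟨m, hm⟩ : ∃ m, U.time κ = m + 1 := ⟨U.time κ - 1, by omega⟩
  have key : ∀ k : Fin U.size,
      Function.update V.time (g.map κ) n (g.map k) ≤ Function.update U.time κ m k := by
    intro k
    have hk : V.time (g.map k) ≤ U.time k := World.Hom.le g k
    by_cases h2 : k = κ
    · subst h2
      rw [Function.update_self, Function.update_self]; omega
    · by_cases h1 : g.map k = g.map κ
      · rw [h1] at hk ⊢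
        rw [Function.update_self, Function.update_of_ne h2]; omega
      · rw [Function.update_of_ne h1, Function.update_of_ne h2]; exact hk
  let g' : V.set (g.map κ) n ⟶ U.set κ m :=
    World.Hom.mk (V := V.set (g.map κ) n) (U := U.set κ m) g.map key
  exact hφ _ g' (h m hm)

/-! ## Programs -/

/-- Program trees with `n` free variables (de Bruijn indices) at a world. A clock-binding
operator takes a family of trees over all clocks in all future worlds; the trees in which all
these families are natural form the object of programs, `Tm n`. -/
inductive Raw : ℕ → World → Type
  | var {n U} (i : Fin n) : Raw n U
  | lam {n U} (M : Raw (n + 1) U) : Raw n U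
  | klam {n U} (M : ∀ V : World, (V ⟶ U) → Clock V → Raw n V) : Raw n U
  | app {n U} (M N : Raw n U) : Raw n U
  | kapp {n U} (M : Raw n U) (κ : Clock U) : Raw n U
  | fix {n U} (M : Raw (n + 1) U) : Raw n U
  | pair {n U} (M N : Raw n U) : Raw n U
  | fst {n U} (M : Raw n U) : Raw n U
  | snd {n U} (M : Raw n U) : Raw n U
  | star {n U} : Raw n U
  | tt {n U} : Raw n U
  | ff {n U} : Raw n U
  | ite {n U} (Mb Mt Mf : Raw n U) : Raw n U
  | ze {n U} : Raw n U
  | su {n U} (M : Raw n U) : Raw n U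
  | ifze {n U} (Mn Mz : Raw n U) (Ms : Raw (n + 1) U) : Raw n U
  | sup {n U} (M : Raw n U) (N : Raw (n + 1) U) : Raw n U
  | wrec {n U} (M : Raw n U) (N : Raw (n + 3) U) : Raw n U
  | pi {n U} (A : Raw n U) (B : Raw (n + 1) U) : Raw n U
  | sg {n U} (A : Raw n U) (B : Raw (n + 1) U) : Raw n U
  | w {n U} (A : Raw n U) (B : Raw (n + 1) U) : Raw n U
  | eq {n U} (A M N : Raw n U) : Raw n U
  | later {n U} (κ : Clock U) (A : Raw n U) : Raw n U
  | isect {n U} (A : ∀ V : World, (V ⟶ U) → Clock V → Raw n V) : Raw n U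
  | kprod {n U} (A : ∀ V : World, (V ⟶ U) → Clock V → Raw n V) : Raw n U
  | void {n U} : Raw n U
  | unit {n U} : Raw n U
  | bool {n U} : Raw n U
  | nat {n U} : Raw n U
  | univ {n U} (i : ℕ) : Raw n U

namespace Raw

/-- Restriction along a morphism of worlds. -/
def rs : ∀ {n : ℕ} {U V : World}, (V ⟶ U) → Raw n U → Raw n V
  | _, _, _, _, var i => var i
  | _, _, _, f, lam M => lam (M.rs f)
  | _, _, _, f, klam M => klam fun W g κ => M W (g ≫ f) κ
  | _, _, _, f, app M N => app (M.rs f) (N.rs f)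
  | _, _, _, f, kapp M κ => kapp (M.rs f) (res f κ)
  | _, _, _, f, fix M => fix (M.rs f)
  | _, _, _, f, pair M N => pair (M.rs f) (N.rs f)
  | _, _, _, f, fst M => fst (M.rs f)
  | _, _, _, f, snd M => snd (M.rs f)
  | _, _, _, _, star => star
  | _, _, _, _, tt => tt
  | _, _, _, _, ff => ff
  | _, _, _, f, ite Mb Mt Mf => ite (Mb.rs f) (Mt.rs f) (Mf.rs f)
  | _, _, _, _, ze => ze
  | _, _, _, f, su M => su (M.rs f)
  | _, _, _, f, ifze Mn Mz Ms => ifze (Mn.rs f) (Mz.rs f) (Ms.rs f)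
  | _, _, _, f, sup M N => sup (M.rs f) (N.rs f)
  | _, _, _, f, wrec M N => wrec (M.rs f) (N.rs f)
  | _, _, _, f, pi A B => pi (A.rs f) (B.rs f)
  | _, _, _, f, sg A B => sg (A.rs f) (B.rs f)
  | _, _, _, f, w A B => w (A.rs f) (B.rs f)
  | _, _, _, f, eq A M N => eq (A.rs f) (M.rs f) (N.rs f)
  | _, _, _, f, later κ A => later (res f κ) (A.rs f)
  | _, _, _, f, isect A => isect fun W g κ => A W (g ≫ f) κ
  | _, _, _, f, kprod A => kprod fun W g κ => A W (g ≫ f) κ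
  | _, _, _, _, void => void
  | _, _, _, _, unit => unit
  | _, _, _, _, bool => bool
  | _, _, _, _, nat => nat
  | _, _, _, _, univ i => univ i

/-- Hereditary naturality of the families under clock binders. -/
def IsNat : ∀ {n : ℕ} {U : World}, Raw n U → Prop
  | _, _, var _ => True
  | _, _, lam M => M.IsNat
  | _, U, klam M => (∀ V (f : V ⟶ U) κ, (M V f κ).IsNat) ∧
      ∀ V (f : V ⟶ U) κ W (g : W ⟶ V), (M V f κ).rs g = M W (g ≫ f) (res g κ)
  | _, _, app M N => M.IsNat ∧ N.IsNat
  | _, _, kapp M _ => M.IsNat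
  | _, _, fix M => M.IsNat
  | _, _, pair M N => M.IsNat ∧ N.IsNat
  | _, _, fst M => M.IsNat
  | _, _, snd M => M.IsNat
  | _, _, star => True
  | _, _, tt => True
  | _, _, ff => True
  | _, _, ite Mb Mt Mf => Mb.IsNat ∧ Mt.IsNat ∧ Mf.IsNat
  | _, _, ze => True
  | _, _, su M => M.IsNat
  | _, _, ifze Mn Mz Ms => Mn.IsNat ∧ Mz.IsNat ∧ Ms.IsNat
  | _, _, sup M N => M.IsNat ∧ N.IsNat
  | _, _, wrec M N => M.IsNat ∧ N.IsNat
  | _, _, pi A B => A.IsNat ∧ B.IsNat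
  | _, _, sg A B => A.IsNat ∧ B.IsNat
  | _, _, w A B => A.IsNat ∧ B.IsNat
  | _, _, eq A M N => A.IsNat ∧ M.IsNat ∧ N.IsNat
  | _, _, later _ A => A.IsNat
  | _, U, isect A => (∀ V (f : V ⟶ U) κ, (A V f κ).IsNat) ∧
      ∀ V (f : V ⟶ U) κ W (g : W ⟶ V), (A V f κ).rs g = A W (g ≫ f) (res g κ)
  | _, U, kprod A => (∀ V (f : V ⟶ U) κ, (A V f κ).IsNat) ∧
      ∀ V (f : V ⟶ U) κ W (g : W ⟶ V), (A V f κ).rs g = A W (g ≫ f) (res g κ)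
  | _, _, void => True
  | _, _, unit => True
  | _, _, bool => True
  | _, _, nat => True
  | _, _, univ _ => True

/-- Extension of a renaming under a binder; the bound variable has index `0`. -/
def liftR {m n : ℕ} (ρ : Fin m → Fin n) : Fin (m + 1) → Fin (n + 1) :=
  Fin.cons 0 fun i => (ρ i).succ

/-- Renaming of variables. -/
def rename : ∀ {m n : ℕ} {U : World}, (Fin m → Fin n) → Raw m U → Raw n U
  | _, _, _, ρ, var i => var (ρ i)
  | _, _, _, ρ, lam M => lam (M.rename (liftR ρ))
  | _, _, _, ρ, klam M => klam fun V f κ => (M V f κ).rename ρ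
  | _, _, _, ρ, app M N => app (M.rename ρ) (N.rename ρ)
  | _, _, _, ρ, kapp M κ => kapp (M.rename ρ) κ
  | _, _, _, ρ, fix M => fix (M.rename (liftR ρ))
  | _, _, _, ρ, pair M N => pair (M.rename ρ) (N.rename ρ)
  | _, _, _, ρ, fst M => fst (M.rename ρ)
  | _, _, _, ρ, snd M => snd (M.rename ρ)
  | _, _, _, _, star => star
  | _, _, _, _, tt => tt
  | _, _, _, _, ff => ff
  | _, _, _, ρ, ite Mb Mt Mf => ite (Mb.rename ρ) (Mt.rename ρ) (Mf.rename ρ)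
  | _, _, _, _, ze => ze
  | _, _, _, ρ, su M => su (M.rename ρ)
  | _, _, _, ρ, ifze Mn Mz Ms => ifze (Mn.rename ρ) (Mz.rename ρ) (Ms.rename (liftR ρ))
  | _, _, _, ρ, sup M N => sup (M.rename ρ) (N.rename (liftR ρ))
  | _, _, _, ρ, wrec M N => wrec (M.rename ρ) (N.rename (liftR (liftR (liftR ρ))))
  | _, _, _, ρ, pi A B => pi (A.rename ρ) (B.rename (liftR ρ))
  | _, _, _, ρ, sg A B => sg (A.rename ρ) (B.rename (liftR ρ))
  | _, _, _, ρ, w A B => w (A.rename ρ) (B.rename (liftR ρ))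
  | _, _, _, ρ, eq A M N => eq (A.rename ρ) (M.rename ρ) (N.rename ρ)
  | _, _, _, ρ, later κ A => later κ (A.rename ρ)
  | _, _, _, ρ, isect A => isect fun V f κ => (A V f κ).rename ρ
  | _, _, _, ρ, kprod A => kprod fun V f κ => (A V f κ).rename ρ
  | _, _, _, _, void => void
  | _, _, _, _, unit => unit
  | _, _, _, _, bool => bool
  | _, _, _, _, nat => nat
  | _, _, _, _, univ i => univ i

/-- Extension of a substitution under a binder. -/
def liftS {m n : ℕ} {U : World} (γ : Fin m → Raw n U) : Fin (m + 1) → Raw (n + 1) U :=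
  Fin.cons (var 0) fun i => (γ i).rename Fin.succ

/-- Simultaneous substitution. -/
def subst : ∀ {m n : ℕ} {U : World}, (Fin m → Raw n U) → Raw m U → Raw n U
  | _, _, _, γ, var i => γ i
  | _, _, _, γ, lam M => lam (M.subst (liftS γ))
  | _, _, _, γ, klam M => klam fun V f κ => (M V f κ).subst fun i => (γ i).rs f
  | _, _, _, γ, app M N => app (M.subst γ) (N.subst γ)
  | _, _, _, γ, kapp M κ => kapp (M.subst γ) κ
  | _, _, _, γ, fix M => fix (M.subst (liftS γ))
  | _, _, _, γ, pair M N => pair (M.subst γ) (N.subst γ)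
  | _, _, _, γ, fst M => fst (M.subst γ)
  | _, _, _, γ, snd M => snd (M.subst γ)
  | _, _, _, _, star => star
  | _, _, _, _, tt => tt
  | _, _, _, _, ff => ff
  | _, _, _, γ, ite Mb Mt Mf => ite (Mb.subst γ) (Mt.subst γ) (Mf.subst γ)
  | _, _, _, _, ze => ze
  | _, _, _, γ, su M => su (M.subst γ)
  | _, _, _, γ, ifze Mn Mz Ms => ifze (Mn.subst γ) (Mz.subst γ) (Ms.subst (liftS γ))
  | _, _, _, γ, sup M N => sup (M.subst γ) (N.subst (liftS γ))
  | _, _, _, γ, wrec M N => wrec (M.subst γ) (N.subst (liftS (liftS (liftS γ))))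
  | _, _, _, γ, pi A B => pi (A.subst γ) (B.subst (liftS γ))
  | _, _, _, γ, sg A B => sg (A.subst γ) (B.subst (liftS γ))
  | _, _, _, γ, w A B => w (A.subst γ) (B.subst (liftS γ))
  | _, _, _, γ, eq A M N => eq (A.subst γ) (M.subst γ) (N.subst γ)
  | _, _, _, γ, later κ A => later κ (A.subst γ)
  | _, _, _, γ, isect A => isect fun V f κ => (A V f κ).subst fun i => (γ i).rs f
  | _, _, _, γ, kprod A => kprod fun V f κ => (A V f κ).subst fun i => (γ i).rs f
  | _, _, _, _, void => void
  | _, _, _, _, unit => unit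
  | _, _, _, _, bool => bool
  | _, _, _, _, nat => nat
  | _, _, _, _, univ i => univ i

theorem rs_id {n : ℕ} {U : World} (M : Raw n U) : M.rs (𝟙 U) = M := by
  induction M <;> simp_all [rs, res_id]

theorem rs_comp {n : ℕ} {U V W : World} (g : W ⟶ V) (f : V ⟶ U) (M : Raw n U) :
    M.rs (g ≫ f) = (M.rs f).rs g := by
  induction M generalizing V W <;> simp_all [rs, res_comp]

theorem IsNat.rs {n : ℕ} {U V : World} (f : V ⟶ U) {M : Raw n U} (h : M.IsNat) :
    (M.rs f).IsNat := by
  induction M generalizing V <;> simp_all [Raw.rs, IsNat]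

theorem rs_rename {m n : ℕ} {U V : World} (f : V ⟶ U) (ρ : Fin m → Fin n) (M : Raw m U) :
    (M.rename ρ).rs f = (M.rs f).rename ρ := by
  induction M generalizing n V <;> simp_all [Raw.rs, rename]

theorem IsNat.rename {m n : ℕ} {U : World} (ρ : Fin m → Fin n) {M : Raw m U} (h : M.IsNat) :
    (M.rename ρ).IsNat := by
  induction M generalizing n <;> simp_all [Raw.rename, IsNat, rs_rename]

theorem rs_liftS {m n : ℕ} {U V : World} (f : V ⟶ U) (γ : Fin m → Raw n U) :
    (fun i => (liftS γ i).rs f) = liftS fun i => (γ i).rs f := by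
  funext i
  refine Fin.cases ?_ (fun j => ?_) i <;> simp [liftS, Raw.rs, rs_rename]

theorem rs_subst {m n : ℕ} {U V : World} (f : V ⟶ U) (γ : Fin m → Raw n U) (M : Raw m U) :
    (M.subst γ).rs f = (M.rs f).subst fun i => (γ i).rs f := by
  induction M generalizing n V <;> simp_all [Raw.rs, subst, rs_liftS, rs_comp]

theorem IsNat.liftS {m n : ℕ} {U : World} {γ : Fin m → Raw n U} (h : ∀ i, (γ i).IsNat) :
    ∀ i, (Raw.liftS γ i).IsNat := by
  intro i
  refine Fin.cases ?_ (fun j => ?_) i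
  · simp [Raw.liftS, IsNat]
  · simpa [Raw.liftS] using (h j).rename _

theorem IsNat.subst {m n : ℕ} {U : World} {γ : Fin m → Raw n U} {M : Raw m U}
    (h : M.IsNat) (hγ : ∀ i, (γ i).IsNat) : (M.subst γ).IsNat := by
  induction M generalizing n with
  | wrec M N ihM ihN =>
    exact ⟨ihM h.1 hγ, ihN h.2 (IsNat.liftS (IsNat.liftS (IsNat.liftS hγ)))⟩
  | _ => simp_all [Raw.subst, IsNat, rs_subst, ← rs_comp, IsNat.liftS, IsNat.rs]

end Raw


/-- The object of programs with `n` free variables. -/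
@[ext]
structure Tm (n : ℕ) (U : World) where
  raw : Raw n U
  isNat : raw.IsNat

instance (n : ℕ) : Presheaf (Tm n) where
  res f M := ⟨M.raw.rs f, M.isNat.rs f⟩
  res_id M := by ext; exact M.raw.rs_id
  res_comp g f M := by ext; exact M.raw.rs_comp g f

/-- The object of closed programs. -/
abbrev Prog : World → Type := Tm 0

namespace Tm
variable {n : ℕ} {U : World}

def var (i : Fin n) : Tm n U := ⟨.var i, trivial⟩
def lam (M : Tm (n + 1) U) : Tm n U := ⟨.lam M.raw, M.isNat⟩
def klam (M : Exp Clock (Tm n) U) : Tm n U :=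
  ⟨.klam fun _ f κ => (M.app f κ).raw,
    fun _ f κ => (M.app f κ).isNat, fun _ f κ _ g => congrArg raw (M.nat f g κ)⟩
def app (M N : Tm n U) : Tm n U := ⟨.app M.raw N.raw, M.isNat, N.isNat⟩
def kapp (M : Tm n U) (κ : Clock U) : Tm n U := ⟨.kapp M.raw κ, M.isNat⟩
def fix (M : Tm (n + 1) U) : Tm n U := ⟨.fix M.raw, M.isNat⟩
def pair (M N : Tm n U) : Tm n U := ⟨.pair M.raw N.raw, M.isNat, N.isNat⟩
def fst (M : Tm n U) : Tm n U := ⟨.fst M.raw, M.isNat⟩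
def snd (M : Tm n U) : Tm n U := ⟨.snd M.raw, M.isNat⟩
def star : Tm n U := ⟨.star, trivial⟩
def tt : Tm n U := ⟨.tt, trivial⟩
def ff : Tm n U := ⟨.ff, trivial⟩
def ite (Mb Mt Mf : Tm n U) : Tm n U :=
  ⟨.ite Mb.raw Mt.raw Mf.raw, Mb.isNat, Mt.isNat, Mf.isNat⟩
def ze : Tm n U := ⟨.ze, trivial⟩
def su (M : Tm n U) : Tm n U := ⟨.su M.raw, M.isNat⟩
def ifze (Mn Mz : Tm n U) (Ms : Tm (n + 1) U) : Tm n U :=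
  ⟨.ifze Mn.raw Mz.raw Ms.raw, Mn.isNat, Mz.isNat, Ms.isNat⟩
def sup (M : Tm n U) (N : Tm (n + 1) U) : Tm n U := ⟨.sup M.raw N.raw, M.isNat, N.isNat⟩
def wrec (M : Tm n U) (N : Tm (n + 3) U) : Tm n U := ⟨.wrec M.raw N.raw, M.isNat, N.isNat⟩
def pi (A : Tm n U) (B : Tm (n + 1) U) : Tm n U := ⟨.pi A.raw B.raw, A.isNat, B.isNat⟩
def sg (A : Tm n U) (B : Tm (n + 1) U) : Tm n U := ⟨.sg A.raw B.raw, A.isNat, B.isNat⟩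
def w (A : Tm n U) (B : Tm (n + 1) U) : Tm n U := ⟨.w A.raw B.raw, A.isNat, B.isNat⟩
def eq (A M N : Tm n U) : Tm n U := ⟨.eq A.raw M.raw N.raw, A.isNat, M.isNat, N.isNat⟩
def later (κ : Clock U) (A : Tm n U) : Tm n U := ⟨.later κ A.raw, A.isNat⟩
def isect (A : Exp Clock (Tm n) U) : Tm n U :=
  ⟨.isect fun _ f κ => (A.app f κ).raw,
    fun _ f κ => (A.app f κ).isNat, fun _ f κ _ g => congrArg raw (A.nat f g κ)⟩
def kprod (A : Exp Clock (Tm n) U) : Tm n U :=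
  ⟨.kprod fun _ f κ => (A.app f κ).raw,
    fun _ f κ => (A.app f κ).isNat, fun _ f κ _ g => congrArg raw (A.nat f g κ)⟩
def void : Tm n U := ⟨.void, trivial⟩
def unit : Tm n U := ⟨.unit, trivial⟩
def bool : Tm n U := ⟨.bool, trivial⟩
def nat : Tm n U := ⟨.nat, trivial⟩
def univ (i : ℕ) : Tm n U := ⟨.univ i, trivial⟩

def rename {m : ℕ} (ρ : Fin m → Fin n) (M : Tm m U) : Tm n U :=
  ⟨M.raw.rename ρ, M.isNat.rename ρ⟩

def subst {m : ℕ} (γ : Fin m → Tm n U) (M : Tm m U) : Tm n U :=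
  ⟨M.raw.subst fun i => (γ i).raw, M.isNat.subst fun i => (γ i).isNat⟩

/-- Substitution of a closed program for the only free variable. -/
def inst (B : Tm 1 U) (M : Prog U) : Prog U := B.subst fun _ => M

section
variable {V : World} (f : V ⟶ U)

@[simp] theorem res_lam M :
    res f (.lam M : Tm n U) = .lam (res f M) := rfl
@[simp] theorem res_klam M :
    res f (.klam M : Tm n U) = .klam (res f M) := rfl
@[simp] theorem res_app M N :
    res f (.app M N : Tm n U) = .app (res f M) (res f N) := rfl
@[simp] theorem res_kapp M κ :
    res f (.kapp M κ : Tm n U) = .kapp (res f M) (res f κ) := rfl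
@[simp] theorem res_fix M :
    res f (.fix M : Tm n U) = .fix (res f M) := rfl
@[simp] theorem res_pair M N :
    res f (.pair M N : Tm n U) = .pair (res f M) (res f N) := rfl
@[simp] theorem res_fst M :
    res f (.fst M : Tm n U) = .fst (res f M) := rfl
@[simp] theorem res_snd M :
    res f (.snd M : Tm n U) = .snd (res f M) := rfl
@[simp] theorem res_star :
    res f (.star : Tm n U) = .star := rfl
@[simp] theorem res_tt :
    res f (.tt : Tm n U) = .tt := rfl
@[simp] theorem res_ff :
    res f (.ff : Tm n U) = .ff := rfl
@[simp] theorem res_ite M N O :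
    res f (.ite M N O : Tm n U) = .ite (res f M) (res f N) (res f O) := rfl
@[simp] theorem res_ze :
    res f (.ze : Tm n U) = .ze := rfl
@[simp] theorem res_su M :
    res f (.su M : Tm n U) = .su (res f M) := rfl
@[simp] theorem res_ifze M N O :
    res f (.ifze M N O : Tm n U) = .ifze (res f M) (res f N) (res f O) := rfl
@[simp] theorem res_sup M N :
    res f (.sup M N : Tm n U) = .sup (res f M) (res f N) := rfl
@[simp] theorem res_wrec M N :
    res f (.wrec M N : Tm n U) = .wrec (res f M) (res f N) := rfl
@[simp] theorem res_pi M N :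
    res f (.pi M N : Tm n U) = .pi (res f M) (res f N) := rfl
@[simp] theorem res_sg M N :
    res f (.sg M N : Tm n U) = .sg (res f M) (res f N) := rfl
@[simp] theorem res_w M N :
    res f (.w M N : Tm n U) = .w (res f M) (res f N) := rfl
@[simp] theorem res_eq M N O :
    res f (.eq M N O : Tm n U) = .eq (res f M) (res f N) (res f O) := rfl
@[simp] theorem res_later κ M :
    res f (.later κ M : Tm n U) = .later (res f κ) (res f M) := rfl
@[simp] theorem res_isect M :
    res f (.isect M : Tm n U) = .isect (res f M) := rfl
@[simp] theorem res_kprod M :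
    res f (.kprod M : Tm n U) = .kprod (res f M) := rfl
@[simp] theorem res_void :
    res f (.void : Tm n U) = .void := rfl
@[simp] theorem res_unit :
    res f (.unit : Tm n U) = .unit := rfl
@[simp] theorem res_bool :
    res f (.bool : Tm n U) = .bool := rfl
@[simp] theorem res_nat :
    res f (.nat : Tm n U) = .nat := rfl
@[simp] theorem res_univ (i : ℕ) : res f (.univ i : Tm n U) = .univ i := rfl

end

@[simp] theorem res_rename {m : ℕ} {V : World} (f : V ⟶ U) (ρ : Fin m → Fin n) (M : Tm m U) :
    res f (M.rename ρ) = (res f M).rename ρ := by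
  ext; exact Raw.rs_rename f ρ M.raw

@[simp] theorem res_subst {m : ℕ} {V : World} (f : V ⟶ U) (γ : Fin m → Tm n U) (M : Tm m U) :
    res f (M.subst γ) = (res f M).subst fun i => res f (γ i) := by
  ext; exact Raw.rs_subst f _ M.raw

@[simp] theorem res_inst {V : World} (f : V ⟶ U) (B : Tm 1 U) (M : Prog U) :
    res f (B.inst M) = (res f B).inst (res f M) := res_subst f _ B

end Tm

/-! ## Operational semantics -/

/-- Canonical forms. -/
inductive Val {U : World} : Prog U → Prop
  | lam M : Val (.lam M)
  | klam M : Val (.klam M)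
  | pair M N : Val (.pair M N)
  | star : Val .star
  | tt : Val .tt
  | ff : Val .ff
  | ze : Val .ze
  | su M : Val (.su M)
  | sup M N : Val (.sup M N)
  | pi A B : Val (.pi A B)
  | sg A B : Val (.sg A B)
  | w A B : Val (.w A B)
  | eq A M N : Val (.eq A M N)
  | later κ A : Val (.later κ A)
  | isect A : Val (.isect A)
  | kprod A : Val (.kprod A)
  | void : Val .void
  | unit : Val .unit
  | bool : Val .bool
  | nat : Val .nat
  | univ i : Val (.univ i)

/-- The recursive calls `λ b. wrec(N[b]; O)` made by W-type recursion at `sup(M; N)`. -/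
def wrecIH {U : World} (N : Tm 1 U) (O : Tm 3 U) : Prog U :=
  .lam (.wrec N (O.rename Fin.castSucc))

/-- Small-step transition of closed programs. -/
inductive Step {U : World} : Prog U → Prog U → Prop
  | app {M M'} (N) : Step M M' → Step (.app M N) (.app M' N)
  | kapp {M M'} (κ) : Step M M' → Step (.kapp M κ) (.kapp M' κ)
  | fst {M M'} : Step M M' → Step (.fst M) (.fst M')
  | snd {M M'} : Step M M' → Step (.snd M) (.snd M')
  | ite {M M'} (Mt Mf) : Step M M' → Step (.ite M Mt Mf) (.ite M' Mt Mf)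
  | ifze {M M'} (Mz Ms) : Step M M' → Step (.ifze M Mz Ms) (.ifze M' Mz Ms)
  | wrec {M M'} (O) : Step M M' → Step (.wrec M O) (.wrec M' O)
  | app_lam (M : Tm 1 U) (N) : Step (.app (.lam M) N) (M.inst N)
  | kapp_klam (M : Exp Clock Prog U) (κ) : Step (.kapp (.klam M) κ) (M.app (𝟙 U) κ)
  | fst_pair (M N) : Step (.fst (.pair M N)) M
  | snd_pair (M N) : Step (.snd (.pair M N)) N
  | ite_tt (Mt Mf) : Step (.ite .tt Mt Mf) Mt
  | ite_ff (Mt Mf) : Step (.ite .ff Mt Mf) Mf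
  | ifze_ze (Mz Ms) : Step (.ifze .ze Mz Ms) Mz
  | ifze_su (M Mz) (Ms : Tm 1 U) : Step (.ifze (.su M) Mz Ms) (Ms.inst M)
  | wrec_sup (M) (N : Tm 1 U) (O : Tm 3 U) :
      Step (.wrec (.sup M N) O) (O.subst ![wrecIH N O, .lam N, M])
  | fix (M : Tm 1 U) : Step (.fix M) (M.inst (.fix M))

/-- The reflexive-transitive closure of the transition relation. -/
def StepStar {U : World} : Prog U → Prog U → Prop := Relation.ReflTransGen Step

theorem Val.res {U V : World} (f : V ⟶ U) {M : Prog U} (h : Val M) :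
    Val (Presheaf.res f M) := by
  cases h <;> simp <;> constructor

@[simp] theorem res_wrecIH {U V : World} (f : V ⟶ U) (N : Tm 1 U) (O : Tm 3 U) :
    res f (wrecIH N O) = wrecIH (res f N) (res f O) := by
  simp [wrecIH]

theorem Step.res {U V : World} (f : V ⟶ U) {M N : Prog U} (h : Step M N) :
    Step (Presheaf.res f M) (Presheaf.res f N) := by
  induction h with
  | kapp_klam M κ =>
    have e : (Presheaf.res f M).app (𝟙 V) (Presheaf.res f κ)
        = Presheaf.res f (M.app (𝟙 U) κ) := by
      rw [M.nat]; simp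
    rw [← e, Tm.res_kapp, Tm.res_klam]; exact .kapp_klam _ _
  | wrec_sup M N O =>
    have e : (fun i => Presheaf.res f ((![wrecIH N O, .lam N, M] : Fin 3 → Prog U) i)) =
        ![wrecIH (Presheaf.res f N) (Presheaf.res f O), .lam (Presheaf.res f N),
          Presheaf.res f M] := by
      funext i
      fin_cases i <;> simp
    rw [Tm.res_subst, e, Tm.res_wrec, Tm.res_sup]
    exact .wrec_sup _ _ _
  | _ => simp; constructor <;> assumption

theorem StepStar.res {U V : World} (f : V ⟶ U) {M N : Prog U} (h : StepStar M N) :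
    StepStar (Presheaf.res f M) (Presheaf.res f N) := by
  induction h with
  | refl => exact .refl
  | tail _ h ih => exact .tail ih (h.res f)

/-! ## Relations and candidate type systems -/

/-- The object of binary relations on closed programs. -/
abbrev Rel : World → Type := Pow (Pair Prog Prog)

/-- The object of candidate type systems. -/
abbrev CTS : World → Type := Pow (Pair Prog Rel)

/-- Closure of a relation under evaluation to canonical form. -/
def Rel.valClo {U : World} (R : Rel U) : Rel U where
  mem {V} f p := ∃ M₀ M₁ : Prog V, Val M₀ ∧ Val M₁ ∧
    StepStar p.fst M₀ ∧ StepStar p.snd M₁ ∧ R.mem f ⟨M₀, M₁⟩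
  mono := by
    rintro V W f g p ⟨M₀, M₁, h₀, h₁, s₀, s₁, h⟩
    exact ⟨res g M₀, res g M₁, h₀.res g, h₁.res g, s₀.res g, s₁.res g, R.mono f g _ h⟩

/-- Closure of a candidate type system under evaluation to canonical form. -/
def CTS.valClo {U : World} (τ : CTS U) : CTS U where
  mem {V} f p := ∃ A : Prog V, Val A ∧ StepStar p.fst A ∧ τ.mem f ⟨A, p.snd⟩
  mono := by
    rintro V W f g p ⟨A, h, s, hA⟩
    exact ⟨res g A, h.res g, s.res g, τ.mono f g _ hA⟩

theorem Rel.res_valClo {U V : World} (f : V ⟶ U) (R : Rel U) :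
    res f R.valClo = (res f R).valClo := rfl

theorem CTS.res_valClo {U V : World} (f : V ⟶ U) (τ : CTS U) :
    res f τ.valClo = (res f τ).valClo := rfl

/-! ### The relations interpreting the connectives -/

/-- `{(★, ★)}` -/
def unitRel {U : World} : Rel U :=
  ⟨fun _ p => p = ⟨.star, .star⟩, by rintro V W f g p rfl; rfl⟩

/-- `{(tt, tt), (ff, ff)}` -/
def boolRel {U : World} : Rel U :=
  ⟨fun _ p => p = ⟨.tt, .tt⟩ ∨ p = ⟨.ff, .ff⟩, by
    rintro V W f g p (rfl | rfl)
    · exact .inl rfl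
    · exact .inr rfl⟩

/-- The operator `Y ↦ {(ze, ze)} ∪ {(su M₀, su M₁) | (M₀, M₁) ∈ valClo Y}`. -/
def natStep {U : World} (Y : Rel U) : Rel U where
  mem {V} f p := p = ⟨.ze, .ze⟩ ∨
    ∃ M₀ M₁ : Prog V, p = ⟨.su M₀, .su M₁⟩ ∧ Y.valClo.mem f ⟨M₀, M₁⟩
  mono := by
    rintro V W f g p (rfl | ⟨M₀, M₁, rfl, h⟩)
    · exact .inl rfl
    · exact .inr ⟨res g M₀, res g M₁, rfl, Y.valClo.mono f g _ h⟩

def natRel {U : World} : Rel U := Pow.lfp ⟨fun _ Y => natStep Y, fun _ _ _ => rfl⟩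

/-- `{(M₀, M₁) | (fst M₀, fst M₁) ∈ 𝒜 ∧ (snd M₀, snd M₁) ∈ ℬ(fst M₀)}` -/
def sgRel {U : World} (𝒜 : Rel U) (ℬ : Exp Prog Rel U) : Rel U where
  mem {V} f p := 𝒜.mem f ⟨p.fst.fst, p.snd.fst⟩ ∧
    (ℬ.app f p.fst.fst).mem (𝟙 V) ⟨p.fst.snd, p.snd.snd⟩
  mono := by
    rintro V W f g p ⟨h₁, h₂⟩
    refine ⟨𝒜.mono f g _ h₁, ?_⟩
    have e : ℬ.app (g ≫ f) (res g p.fst).fst = res g (ℬ.app f p.fst.fst) := by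
      rw [ℬ.nat, Tm.res_fst]
    have := (ℬ.app f p.fst.fst).mono _ g _ h₂
    simpa [e] using this

/-- `{(M₀, M₁) | ∀ (N₀, N₁) ∈ 𝒜. (M₀ N₀, M₁ N₁) ∈ ℬ(N₀)}` -/
def piRel {U : World} (𝒜 : Rel U) (ℬ : Exp Prog Rel U) : Rel U where
  mem {V} f p := ∀ (W : World) (g : W ⟶ V) (N₀ N₁ : Prog W), 𝒜.mem (g ≫ f) ⟨N₀, N₁⟩ →
    (ℬ.app (g ≫ f) N₀).mem (𝟙 W) ⟨(res g p.fst).app N₀, (res g p.snd).app N₁⟩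
  mono := by
    intro V W f g p h X k N₀ N₁ hN
    have := h X (k ≫ g) N₀ N₁ (by simpa using hN)
    simpa [res_comp] using this

/-- The operator `Y ↦ {(sup(M₀; N₀), sup(M₁; N₁)) | (M₀, M₁) ∈ 𝒜 ∧
∀ (O₀, O₁) ∈ ℬ(M₀). (N₀[O₀], N₁[O₁]) ∈ valClo Y}`. -/
def wStep {U : World} (𝒜 : Rel U) (ℬ : Exp Prog Rel U) (Y : Rel U) : Rel U where
  mem {V} f p := ∃ (M₀ M₁ : Prog V) (N₀ N₁ : Tm 1 V), p = ⟨.sup M₀ N₀, .sup M₁ N₁⟩ ∧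
    𝒜.mem f ⟨M₀, M₁⟩ ∧
    ∀ (W : World) (g : W ⟶ V) (O₀ O₁ : Prog W), (ℬ.app f M₀).mem g ⟨O₀, O₁⟩ →
      Y.valClo.mem (g ≫ f) ⟨(res g N₀).inst O₀, (res g N₁).inst O₁⟩
  mono := by
    rintro V W f g p ⟨M₀, M₁, N₀, N₁, rfl, hM, h⟩
    refine ⟨res g M₀, res g M₁, res g N₀, res g N₁, rfl, 𝒜.mono f g _ hM, ?_⟩
    intro X k O₀ O₁ hO
    rw [← ℬ.nat] at hO
    simpa [res_comp] using h X (k ≫ g) O₀ O₁ hO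

theorem res_wStep {U V : World} (f : V ⟶ U) (𝒜 : Rel U) (ℬ : Exp Prog Rel U) (Y : Rel U) :
    res f (wStep 𝒜 ℬ Y) = wStep (res f 𝒜) (res f ℬ) (res f Y) := by
  ext W g p
  simp [res, wStep, Rel.valClo]

def wRel {U : World} (𝒜 : Rel U) (ℬ : Exp Prog Rel U) : Rel U :=
  Pow.lfp ⟨fun f Y => wStep (res f 𝒜) (res f ℬ) Y, fun f g Y => by
    rw [res_wStep, res_comp, res_comp]⟩

/-- `{(★, ★) | (M₀, M₁) ∈ 𝒜}` -/
def eqRel {U : World} (𝒜 : Rel U) (M₀ M₁ : Prog U) : Rel U where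
  mem f p := p = ⟨.star, .star⟩ ∧ 𝒜.mem f ⟨res f M₀, res f M₁⟩
  mono := by
    rintro V W f g p ⟨rfl, h⟩
    exact ⟨rfl, by simpa [res_comp] using 𝒜.mono f g _ h⟩

/-- `{(M₀, M₁) | ▷κ ((M₀, M₁) ∈ 𝒜)}` -/
def laterRel {U : World} (κ : Clock U) (𝒜 : Rel U) : Rel U where
  mem f p := Later (res f κ) fun g => 𝒜.mem (g ≫ f) (res g p)
  mono := by
    intro V W f g p h
    have := Later.mono (fun f' g' h' => by
      simpa [res_comp] using 𝒜.mono _ g' _ h') g h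
    simpa [res_comp] using this

/-- `{(M₀, M₁) | ∀ κ. (M₀, M₁) ∈ 𝒜(κ)}` -/
def isectRel {U : World} (𝒜 : Exp Clock Rel U) : Rel U where
  mem {V} f p := ∀ (W : World) (g : W ⟶ V) (κ : Clock W),
    (𝒜.app (g ≫ f) κ).mem (𝟙 W) (res g p)
  mono := by
    intro V W f g p h X k κ
    simpa [res_comp] using h X (k ≫ g) κ

/-- `{(M₀, M₁) | ∀ κ. (M₀ κ, M₁ κ) ∈ 𝒜(κ)}` -/
def kprodRel {U : World} (𝒜 : Exp Clock Rel U) : Rel U where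
  mem {V} f p := ∀ (W : World) (g : W ⟶ V) (κ : Clock W),
    (𝒜.app (g ≫ f) κ).mem (𝟙 W) ⟨(res g p.fst).kapp κ, (res g p.snd).kapp κ⟩
  mono := by
    intro V W f g p h X k κ
    simpa [res_comp] using h X (k ≫ g) κ

/-! ### The closure conditions

Each condition is stated as what it means for a pair `(T, X)` to be in the given clause at the
current stage. -/

/-- The relations `ℬ` interpret the family `B` of types over the relation `𝒜`. -/
def IsFam {U : World} (τ : CTS U) (𝒜 : Rel U) (B : Tm 1 U) (ℬ : Exp Prog Rel U) : Prop :=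
  ∀ (V : World) (f : V ⟶ U) (M₀ M₁ : Prog V), 𝒜.mem f ⟨M₀, M₁⟩ →
    τ.mem f ⟨(res f B).inst M₀, ℬ.app f M₀⟩ ∧
    τ.mem f ⟨(res f B).inst M₁, ℬ.app f M₀⟩ ∧
    τ.mem f ⟨(res f B).inst M₁, ℬ.app f M₁⟩ ∧
    τ.mem f ⟨(res f B).inst M₀, ℬ.app f M₁⟩

/-- `(T, X)` is in one of the clauses for the connectives other than universes. -/
inductive Conn {U : World} (τ : CTS U) : Prog U → Rel U → Prop
  | void : Conn τ .void Pow.empty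
  | unit : Conn τ .unit unitRel.valClo
  | bool : Conn τ .bool boolRel.valClo
  | nat : Conn τ .nat natRel.valClo
  | sg (A B) (𝒜 : Rel U) (ℬ : Exp Prog Rel U) :
      τ.mem (𝟙 U) ⟨A, 𝒜⟩ → IsFam τ 𝒜 B ℬ → Conn τ (.sg A B) (sgRel 𝒜 ℬ)
  | pi (A B) (𝒜 : Rel U) (ℬ : Exp Prog Rel U) :
      τ.mem (𝟙 U) ⟨A, 𝒜⟩ → IsFam τ 𝒜 B ℬ → Conn τ (.pi A B) (piRel 𝒜 ℬ)
  | w (A B) (𝒜 : Rel U) (ℬ : Exp Prog Rel U) :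
      τ.mem (𝟙 U) ⟨A, 𝒜⟩ → IsFam τ 𝒜 B ℬ → Conn τ (.w A B) (wRel 𝒜 ℬ).valClo
  | eq (A M₀ M₁) (𝒜 : Rel U) :
      τ.mem (𝟙 U) ⟨A, 𝒜⟩ → 𝒜.mem (𝟙 U) ⟨M₀, M₀⟩ → 𝒜.mem (𝟙 U) ⟨M₁, M₁⟩ →
      Conn τ (.eq A M₀ M₁) (eqRel 𝒜 M₀ M₁).valClo
  | later (κ) (A) (𝒜 : Rel U) :
      Later κ (fun f => τ.mem f (res f ⟨A, 𝒜⟩)) → Conn τ (.later κ A) (laterRel κ 𝒜)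
  | isect (A : Exp Clock Prog U) (𝒜 : Exp Clock Rel U) :
      (∀ (V : World) (f : V ⟶ U) (κ : Clock V), τ.mem f ⟨A.app f κ, 𝒜.app f κ⟩) →
      Conn τ (.isect A) (isectRel 𝒜)
  | kprod (A : Exp Clock Prog U) (𝒜 : Exp Clock Rel U) :
      (∀ (V : World) (f : V ⟶ U) (κ : Clock V), τ.mem f ⟨A.app f κ, 𝒜.app f κ⟩) →
      Conn τ (.kprod A) (kprodRel 𝒜)

theorem IsFam.res {U V : World} {τ : CTS U} {𝒜 : Rel U} {B : Tm 1 U} {ℬ : Exp Prog Rel U}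
    (f : V ⟶ U) (h : IsFam τ 𝒜 B ℬ) :
    IsFam (res f τ) (res f 𝒜) (res f B) (res f ℬ) := by
  intro W g M₀ M₁ hM
  simpa [res_comp] using h W (g ≫ f) M₀ M₁ hM

theorem res_natRel {U V : World} (f : V ⟶ U) : res f (natRel : Rel U) = natRel :=
  Pow.res_lfp f _

theorem res_sgRel {U V : World} (f : V ⟶ U) (𝒜 : Rel U) (ℬ : Exp Prog Rel U) :
    res f (sgRel 𝒜 ℬ) = sgRel (res f 𝒜) (res f ℬ) := rfl

theorem res_piRel {U V : World} (f : V ⟶ U) (𝒜 : Rel U) (ℬ : Exp Prog Rel U) :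
    res f (piRel 𝒜 ℬ) = piRel (res f 𝒜) (res f ℬ) := by
  ext W g p
  simp [piRel]

theorem res_wRel {U V : World} (f : V ⟶ U) (𝒜 : Rel U) (ℬ : Exp Prog Rel U) :
    res f (wRel 𝒜 ℬ) = wRel (res f 𝒜) (res f ℬ) := by
  rw [wRel, Pow.res_lfp, wRel]
  congr 1

theorem res_eqRel {U V : World} (f : V ⟶ U) (𝒜 : Rel U) (M₀ M₁ : Prog U) :
    res f (eqRel 𝒜 M₀ M₁) = eqRel (res f 𝒜) (res f M₀) (res f M₁) := by
  ext W g p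
  simp [eqRel, res_comp]

theorem res_laterRel {U V : World} (f : V ⟶ U) (κ : Clock U) (𝒜 : Rel U) :
    res f (laterRel κ 𝒜) = laterRel (res f κ) (res f 𝒜) := by
  ext W g p
  simp [laterRel, res_comp]

theorem res_isectRel {U V : World} (f : V ⟶ U) (𝒜 : Exp Clock Rel U) :
    res f (isectRel 𝒜) = isectRel (res f 𝒜) := by
  ext W g p
  simp [isectRel]

theorem res_kprodRel {U V : World} (f : V ⟶ U) (𝒜 : Exp Clock Rel U) :
    res f (kprodRel 𝒜) = kprodRel (res f 𝒜) := by
  ext W g p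
  simp [kprodRel]

theorem CTS.mem_res {U V : World} (f : V ⟶ U) (τ : CTS U) {A : Prog U} {𝒜 : Rel U}
    (h : τ.mem (𝟙 U) ⟨A, 𝒜⟩) : (res f τ).mem (𝟙 V) ⟨res f A, res f 𝒜⟩ := by
  simpa using τ.mono (𝟙 U) f _ h

theorem Rel.mem_res {U V : World} (f : V ⟶ U) (R : Rel U) {M N : Prog U}
    (h : R.mem (𝟙 U) ⟨M, N⟩) : (res f R).mem (𝟙 V) ⟨res f M, res f N⟩ := by
  simpa using R.mono (𝟙 U) f _ h

theorem Conn.res {U V : World} {τ : CTS U} {T : Prog U} {X : Rel U} (f : V ⟶ U)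
    (h : Conn τ T X) : Conn (Presheaf.res f τ) (Presheaf.res f T) (Presheaf.res f X) := by
  cases h with
  | void => exact .void
  | unit => exact .unit
  | bool => exact .bool
  | nat => rw [Rel.res_valClo, res_natRel]; exact .nat
  | sg A B 𝒜 ℬ h₁ h₂ => exact .sg _ _ _ _ (CTS.mem_res f τ h₁) (h₂.res f)
  | pi A B 𝒜 ℬ h₁ h₂ => rw [res_piRel]; exact .pi _ _ _ _ (CTS.mem_res f τ h₁) (h₂.res f)
  | w A B 𝒜 ℬ h₁ h₂ =>
    rw [Rel.res_valClo, res_wRel]; exact .w _ _ _ _ (CTS.mem_res f τ h₁) (h₂.res f)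
  | eq A M₀ M₁ 𝒜 h₁ h₂ h₃ =>
    rw [Rel.res_valClo, res_eqRel]
    exact .eq _ _ _ _ (CTS.mem_res f τ h₁) (Rel.mem_res f 𝒜 h₂) (Rel.mem_res f 𝒜 h₃)
  | later κ A 𝒜 h =>
    rw [res_laterRel]
    rw [Tm.res_later]
    refine .later _ _ _ ?_
    have := Later.mono (fun f' g' h' => by simpa only [res_comp] using τ.mono _ g' _ h') f h
    simpa [res_comp] using this
  | isect A 𝒜 h =>
    rw [res_isectRel]
    exact .isect (Presheaf.res f A) (Presheaf.res f 𝒜) fun W g κ => h W (g ≫ f) κ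
  | kprod A 𝒜 h =>
    rw [res_kprodRel]
    exact .kprod (Presheaf.res f A) (Presheaf.res f 𝒜) fun W g κ => h W (g ≫ f) κ

/-- The union of the clauses for the connectives, as a candidate type system. -/
def conns {U : World} (τ : CTS U) : CTS U where
  mem f p := Conn (res f τ) p.fst p.snd
  mono f g p h := by simpa [res_comp] using h.res g

/-- The operator extending `σ` with all the non-universe connectives over `τ`. -/
def tyStep {U : World} (σ τ : CTS U) : CTS U := σ.union (conns τ).valClo

theorem res_tyStep {U V : World} (f : V ⟶ U) (σ τ : CTS U) :
    res f (tyStep σ τ) = tyStep (res f σ) (res f τ) := by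
  ext W g p
  simp [tyStep, Pow.union, CTS.valClo, conns, res_comp]

/-- The closure of a candidate type system under the non-universe connectives: the least fixed
point of `τ ↦ tyStep σ τ`. -/
def close {U : World} (σ : CTS U) : CTS U :=
  Pow.lfp ⟨fun f τ => tyStep (res f σ) τ, fun f g τ => by rw [res_tyStep, res_comp]⟩

theorem res_close {U V : World} (f : V ⟶ U) (σ : CTS U) :
    res f (close σ) = close (res f σ) := by
  rw [close, Pow.res_lfp, close]
  congr 1

/-! ## Judgments relative to a candidate type system, at a stage -/

/-- `τ ⊨ A ∼ B type`. -/
def SimType {U : World} (τ : CTS U) (A B : Prog U) : Prop :=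
  ∃ 𝒜 : Rel U, τ.mem (𝟙 U) ⟨A, 𝒜⟩ ∧ τ.mem (𝟙 U) ⟨B, 𝒜⟩

/-- `τ ⊨ M ∼ N ∈ A`. -/
def SimMem {U : World} (τ : CTS U) (M N A : Prog U) : Prop :=
  ∃ 𝒜 : Rel U, τ.mem (𝟙 U) ⟨A, 𝒜⟩ ∧ 𝒜.mem (𝟙 U) ⟨M, N⟩

theorem SimType.res {U V : World} {τ : CTS U} {A B : Prog U} (f : V ⟶ U)
    (h : SimType τ A B) :
    SimType (Presheaf.res f τ) (Presheaf.res f A) (Presheaf.res f B) := by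
  obtain ⟨𝒜, h₁, h₂⟩ := h
  exact ⟨Presheaf.res f 𝒜, CTS.mem_res f τ h₁, CTS.mem_res f τ h₂⟩

/-! ## The universe hierarchy -/

/-- The relation `{(A₀, A₁) | τ ⊨ A₀ ∼ A₁ type}`. -/
def simTypeRel {U : World} (τ : CTS U) : Rel U where
  mem f p := SimType (res f τ) p.fst p.snd
  mono f g p h := by simpa [res_comp] using h.res g

/-- The spine level `n + 1` from the levels `0, …, n`: the universes `univ i` for `i ≤ n`. -/
def spineSucc (n : ℕ) (ν : ∀ i, i ≤ n → Global CTS) : Global CTS where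
  val _ := CTS.valClo
    { mem := fun {V} _ p =>
        ∃ (i : ℕ) (h : i ≤ n), p = ⟨.univ i, simTypeRel (close ((ν i h).val V))⟩
      mono := by
        rintro V W f g p ⟨i, h, rfl⟩
        refine ⟨i, h, ?_⟩
        rw [← (ν i h).nat g, ← res_close]
        ext : 1
        · rfl
        · ext X k q
          simp [simTypeRel, res_comp] }
  nat _ := rfl

/-- The spine of the universe hierarchy. -/
def spine : ℕ → Global CTS
  | 0 => ⟨fun _ => Pow.empty, fun _ => rfl⟩
  | n + 1 => spineSucc n fun i _ => spine i

/-- The type system with `n` universes. -/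
def tower (n : ℕ) : Global CTS :=
  ⟨fun U => close ((spine n).val U), fun f => by rw [res_close, (spine n).nat]⟩

/-- The maximal type system, the join of the hierarchy. -/
def towerω : Global CTS where
  val U :=
    { mem := fun f p => ∃ n, ((tower n).val U).mem f p
      mono := fun f g p ⟨n, h⟩ => ⟨n, ((tower n).val U).mono f g p h⟩ }
  nat {V U} f := by
    ext W g p
    simp only [Pow.res_mem, ← fun n => (tower n).nat f]

/-! ## Telescopes and sequents -/

/-- Telescopes of length `n`. -/
inductive Tele : ℕ → World → Type
  | nil {U} : Tele 0 U
  | snoc {n U} (Γ : Tele n U) (A : Tm n U) : Tele (n + 1) U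

def Tele.rs {V U : World} (f : V ⟶ U) : ∀ {n : ℕ}, Tele n U → Tele n V
  | _, .nil => .nil
  | _, .snoc Γ A => .snoc (Γ.rs f) (res f A)

/-- Similarity of instantiations, `γ₀ ∼ γ₁ ∈ Γ`. The last entry has index `0`. -/
def SimEnv {U : World} (τ : CTS U) :
    ∀ {n : ℕ}, Tele n U → (Fin n → Prog U) → (Fin n → Prog U) → Prop
  | _, .nil, _, _ => True
  | _, .snoc Γ A, γ₀, γ₁ => SimEnv τ Γ (Fin.tail γ₀) (Fin.tail γ₁) ∧
      SimMem τ (γ₀ 0) (γ₁ 0) (A.subst (Fin.tail γ₀))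

/-- Open type similarity, `Γ ≫ A₀ ∼ A₁ type`. -/
def HypSimType {U : World} (τ : CTS U) {n : ℕ} (Γ : Tele n U) (A₀ A₁ : Tm n U) : Prop :=
  ∀ (V : World) (f : V ⟶ U) (γ₀ γ₁ : Fin n → Prog V),
    SimEnv (res f τ) (Γ.rs f) γ₀ γ₁ →
    SimType (res f τ) ((res f A₀).subst γ₀) ((res f A₁).subst γ₁)

/-- Open member similarity, `Γ ≫ M₀ ∼ M₁ ∈ A`. -/
def HypSimMem {U : World} (τ : CTS U) {n : ℕ} (Γ : Tele n U) (M₀ M₁ A : Tm n U) : Prop :=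
  ∀ (V : World) (f : V ⟶ U) (γ₀ γ₁ : Fin n → Prog V),
    SimEnv (res f τ) (Γ.rs f) γ₀ γ₁ →
    SimMem (res f τ) ((res f M₀).subst γ₀) ((res f M₁).subst γ₁) ((res f A).subst γ₀)

/-- Context validity. -/
def IsCtx {U : World} (τ : CTS U) : ∀ {n : ℕ}, Tele n U → Prop
  | _, .nil => True
  | _, .snoc Γ A => IsCtx τ Γ ∧ HypSimType τ Γ A A

/-! ## Formal terms and their elaboration -/

/-- Formal terms with `d` free clock variables and `n` free term variables, up to renaming of
bound variables (de Bruijn indices for both sorts of variables). -/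
inductive Term : ℕ → ℕ → Type
  | var {d n} (i : Fin n) : Term d n
  | lam {d n} (M : Term d (n + 1)) : Term d n
  | klam {d n} (M : Term (d + 1) n) : Term d n
  | app {d n} (M N : Term d n) : Term d n
  | kapp {d n} (M : Term d n) (k : Fin d) : Term d n
  | pair {d n} (M N : Term d n) : Term d n
  | fst {d n} (M : Term d n) : Term d n
  | snd {d n} (M : Term d n) : Term d n
  | fix {d n} (M : Term d (n + 1)) : Term d n
  | star {d n} : Term d n
  | tt {d n} : Term d n
  | ff {d n} : Term d n
  | ite {d n} (M N O : Term d n) : Term d n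
  | ze {d n} : Term d n
  | su {d n} (M : Term d n) : Term d n
  | ifze {d n} (M N : Term d n) (O : Term d (n + 1)) : Term d n
  | sup {d n} (M : Term d n) (N : Term d (n + 1)) : Term d n
  | wrec {d n} (M : Term d n) (N : Term d (n + 3)) : Term d n
  | pi {d n} (A : Term d n) (B : Term d (n + 1)) : Term d n
  | sg {d n} (A : Term d n) (B : Term d (n + 1)) : Term d n
  | w {d n} (A : Term d n) (B : Term d (n + 1)) : Term d n
  | eq {d n} (A M N : Term d n) : Term d n
  | kprod {d n} (A : Term (d + 1) n) : Term d n
  | isect {d n} (A : Term (d + 1) n) : Term d n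
  | later {d n} (k : Fin d) (A : Term d n) : Term d n
  | void {d n} : Term d n
  | unit {d n} : Term d n
  | bool {d n} : Term d n
  | nat {d n} : Term d n
  | univ {d n} (i : ℕ) : Term d n

namespace Term

/-- Extension of a clock environment by a clock for a new variable of index `0`. -/
def envCons {d : ℕ} {U : World} (κ : Clock U) (ϱ : Fin d → Clock U) : Fin (d + 1) → Clock U :=
  Fin.cons κ ϱ

/-- The tree underlying the elaboration of a formal term in a clock environment. -/
def raw : ∀ {d n : ℕ} {U : World}, Term d n → (Fin d → Clock U) → Raw n U
  | _, _, _, var i, _ => .var i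
  | _, _, _, lam M, ϱ => .lam (M.raw ϱ)
  | _, _, _, klam M, ϱ => .klam fun _ f κ => M.raw (envCons κ fun i => res f (ϱ i))
  | _, _, _, app M N, ϱ => .app (M.raw ϱ) (N.raw ϱ)
  | _, _, _, kapp M k, ϱ => .kapp (M.raw ϱ) (ϱ k)
  | _, _, _, pair M N, ϱ => .pair (M.raw ϱ) (N.raw ϱ)
  | _, _, _, fst M, ϱ => .fst (M.raw ϱ)
  | _, _, _, snd M, ϱ => .snd (M.raw ϱ)
  | _, _, _, fix M, ϱ => .fix (M.raw ϱ)
  | _, _, _, star, _ => .star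
  | _, _, _, tt, _ => .tt
  | _, _, _, ff, _ => .ff
  | _, _, _, ite M N O, ϱ => .ite (M.raw ϱ) (N.raw ϱ) (O.raw ϱ)
  | _, _, _, ze, _ => .ze
  | _, _, _, su M, ϱ => .su (M.raw ϱ)
  | _, _, _, ifze M N O, ϱ => .ifze (M.raw ϱ) (N.raw ϱ) (O.raw ϱ)
  | _, _, _, sup M N, ϱ => .sup (M.raw ϱ) (N.raw ϱ)
  | _, _, _, wrec M N, ϱ => .wrec (M.raw ϱ) (N.raw ϱ)
  | _, _, _, pi A B, ϱ => .pi (A.raw ϱ) (B.raw ϱ)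
  | _, _, _, sg A B, ϱ => .sg (A.raw ϱ) (B.raw ϱ)
  | _, _, _, w A B, ϱ => .w (A.raw ϱ) (B.raw ϱ)
  | _, _, _, eq A M N, ϱ => .eq (A.raw ϱ) (M.raw ϱ) (N.raw ϱ)
  | _, _, _, kprod A, ϱ => .kprod fun _ f κ => A.raw (envCons κ fun i => res f (ϱ i))
  | _, _, _, isect A, ϱ => .isect fun _ f κ => A.raw (envCons κ fun i => res f (ϱ i))
  | _, _, _, later k A, ϱ => .later (ϱ k) (A.raw ϱ)
  | _, _, _, void, _ => .void
  | _, _, _, unit, _ => .unit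
  | _, _, _, bool, _ => .bool
  | _, _, _, nat, _ => .nat
  | _, _, _, univ i, _ => .univ i

theorem res_envCons {d : ℕ} {U V : World} (f : V ⟶ U) (κ : Clock U) (ϱ : Fin d → Clock U) :
    (fun i => res f (envCons κ ϱ i)) = envCons (res f κ) fun i => res f (ϱ i) := by
  funext i
  refine Fin.cases ?_ (fun j => ?_) i <;> simp [envCons]

theorem rs_raw {d n : ℕ} {U V : World} (f : V ⟶ U) (M : Term d n) (ϱ : Fin d → Clock U) :
    (M.raw ϱ).rs f = M.raw fun i => res f (ϱ i) := by
  induction M generalizing U V <;> simp_all [raw, Raw.rs, res_comp]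

theorem isNat_raw {d n : ℕ} {U : World} (M : Term d n) (ϱ : Fin d → Clock U) :
    (M.raw ϱ).IsNat := by
  induction M generalizing U <;> simp_all [raw, Raw.IsNat, rs_raw, res_envCons, res_comp]

/-- The elaboration of a formal term into a program, in a clock environment. -/
def sem {d n : ℕ} {U : World} (M : Term d n) (ϱ : Fin d → Clock U) : Tm n U :=
  ⟨M.raw ϱ, M.isNat_raw ϱ⟩

end Term

/-- Formal typing contexts. -/
inductive Ctx (d : ℕ) : ℕ → Type
  | nil : Ctx d 0
  | snoc {n} (Γ : Ctx d n) (A : Term d n) : Ctx d (n + 1)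

/-- The elaboration of a formal context into a telescope. -/
def Ctx.sem {d : ℕ} {U : World} : ∀ {n : ℕ}, Ctx d n → (Fin d → Clock U) → Tele n U
  | _, .nil, _ => .nil
  | _, .snoc Γ A, ϱ => .snoc (Γ.sem ϱ) (A.sem ϱ)

/-! ## The meaning explanation -/

/-- `U ⊩ ⟦Δ | Γ ≫ M₀ = M₁ ∈ A⟧`: the meaning of the equality judgment at stage `U`, namely
`∀ ϱ. IsCtx ⟦Γ⟧ϱ ⇒ HypSimType ⟦Γ⟧ϱ ⟦A⟧ϱ ⟦A⟧ϱ ⇒ HypSimMem ⟦Γ⟧ϱ ⟦M₀⟧ϱ ⟦M₁⟧ϱ ⟦A⟧ϱ`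
in the maximal type system, by the forcing clauses of `∀` and `⇒`. -/
def ForcesEqMem {d n : ℕ} (U : World) (Γ : Ctx d n) (M₀ M₁ A : Term d n) : Prop :=
  ∀ (V : World) (_ : V ⟶ U) (ϱ : Fin d → Clock V),
  ∀ (W : World) (g : W ⟶ V),
    IsCtx (towerω.val W) (Γ.sem fun k => res g (ϱ k)) →
  ∀ (X : World) (h : X ⟶ W),
    HypSimType (towerω.val X) (Γ.sem fun k => res (h ≫ g) (ϱ k))
      (A.sem fun k => res (h ≫ g) (ϱ k)) (A.sem fun k => res (h ≫ g) (ϱ k)) →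
    HypSimMem (towerω.val X) (Γ.sem fun k => res (h ≫ g) (ϱ k))
      (M₀.sem fun k => res (h ≫ g) (ϱ k)) (M₁.sem fun k => res (h ≫ g) (ϱ k))
      (A.sem fun k => res (h ≫ g) (ϱ k))

end GCTT

/-!
The judgment is refuted at the world `U` itself, with every clock variable sent to one chosen clock
of `U`. Its premises hold: the empty context is valid, and `void` is a type with the empty relation
already in the type system without universes (`towerω_void`). Hence if the judgment were forced,
the program elaborating `M` would be related to itself by some relation assigned to `void`.

The closed type systems are least fixed points, so they contain no interpretation of `void` but
the empty one (`void_empty_of_mem_close`). To see this, consider the candidate type system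
`voidEmpty` of those pairs `(T, X)` for which, at every future world where `T` is `void`, the
relation `X` is empty. It is closed under the connectives because a type that evaluates to a
canonical form other than `void` cannot be `void`: canonical `void` makes no transition. It contains
the universes for the same reason.
-/

namespace GCTT

open Presheaf (res res_id res_comp)

theorem Step.raw_ne_void {U : World} {M N : Prog U} (h : Step M N) : M.raw ≠ .void := by
  cases h <;> exact fun e => nomatch e

theorem StepStar.eq_of_void {U : World} {N : Prog U} (h : StepStar .void N) : N = .void := by
  rcases Relation.ReflTransGen.cases_head h with h | ⟨_, h, _⟩
  · exact h.symm
  · exact absurd rfl h.raw_ne_void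

/-- The pairs `(T, X)` such that `T = void` implies that `X` is empty, where the implication is
that of the internal logic and so ranges over all future worlds. -/
def voidEmpty {U : World} : CTS U where
  mem {V} _ p := ∀ (W : World) (g : W ⟶ V), res g p.fst = .void →
    ∀ q : Pair Prog Prog W, ¬ p.snd.mem g q
  mono f g p h W k e q hq := h W (k ≫ g) (by rw [res_comp]; exact e) q hq

theorem Conn.not_mem_of_res_eq_void {U V : World} {τ : CTS U} {T : Prog U} {X : Rel U}
    (h : Conn τ T X) (g : V ⟶ U) (e : Presheaf.res g T = .void) (q : Pair Prog Prog V) :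
    ¬ X.mem g q := by
  have e' := congrArg Tm.raw e
  cases h
  case void => exact id
  all_goals exact nomatch e'

theorem spine_mem {n : ℕ} {U V : World} {f : V ⟶ U} {p : Pair Prog Rel V}
    (h : ((spine n).val U).mem f p) : ∃ i, StepStar p.fst (.univ i) := by
  cases n with
  | zero => rw [spine] at h; exact h.elim
  | succ n =>
    rw [spine] at h
    obtain ⟨A, -, s, i, _, e⟩ := h
    obtain rfl : A = .univ i := congrArg Pair.fst e
    exact ⟨i, s⟩

theorem void_empty_of_mem_close {n : ℕ} {U : World} {X : Rel U}
    (h : (close ((spine n).val U)).mem (𝟙 U) ⟨.void, X⟩) (q : Pair Prog Prog U) :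
    ¬ X.mem (𝟙 U) q := by
  have key := h (𝟙 U) voidEmpty ?_ U (𝟙 U) (by simp [res_id])
  · simpa [res_id] using key q
  rintro V f p (hp | ⟨A, -, s, hA⟩) W g e q
  · obtain ⟨i, s⟩ := spine_mem hp
    have s' := s.res g
    rw [e] at s'
    exact nomatch congrArg Tm.raw s'.eq_of_void
  · have s' := s.res g
    rw [e] at s'
    exact Conn.not_mem_of_res_eq_void hA g s'.eq_of_void q

theorem towerω_void (U : World) : (towerω.val U).mem (𝟙 U) ⟨.void, Pow.empty⟩ := by
  refine ⟨0, fun {W} g Y hY => hY W (𝟙 W) _ ?_⟩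
  exact .inr ⟨.void, .void, .refl, Conn.void⟩

end GCTT

open GCTT in
theorem mainTheorem2 {d : ℕ} (M : GCTT.Term d 0) (U : GCTT.World) :
    ¬ GCTT.ForcesEqMem U GCTT.Ctx.nil M M GCTT.Term.void := by
  intro h
  -- Worlds have at least one clock, so the judgment can be instantiated for any `d`.
  have h₁ := h U (𝟙 U) (fun _ => ⟨0, U.size_pos⟩) U (𝟙 U) trivial U (𝟙 U) ?_ U (𝟙 U)
    Fin.elim0 Fin.elim0 trivial
  · obtain ⟨X, ⟨n, hn⟩, hX⟩ := h₁
    exact void_empty_of_mem_close (n := n) hn _ hX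
  · intro V f γ₀ γ₁ _
    rw [towerω.nat]
    exact ⟨Pow.empty, towerω_void V, towerω_void V⟩
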